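/- For a real symmetric positive semidefinite matrix $A=V\,\mathrm{diag}(\lambda_1,\ldots,\lambda_k)\,V^T$ ($V$ orthogonal) and real $t>0$, let $A^{1/t}=V\,\mathrm{diag}(\lambda_1^{1/t},\ldots,\lambda_k^{1/t})\,V^T$ denote its positive semidefinite $t$th root. Let $m'\ge m$, let $d_1\ge\cdots\ge d_m$ be real numbers and let $w_1,\ldots,w_m\in\mathbb{R}^{m'}$ be linearly independent. Let $u_1,\ldots,u_m$ be the orthonormal set that results from applying the Gram–Schmidt orthonormalization process to $w_1,\ldots,w_m$, and let $u_{m+1},\ldots,u_{m'}$ be any orthonormal basis of the orthogonal complement of the span of $w_1,\ldots,w_m$. Then the limit $$L=\lim_{t\to\infty}\Big[\sum_{i=1}^m e^{t d_i}w_iw_i^T\Big]^{1/t}$$ exists (as $t\to\infty$ through the real numbers); the eigenvalues of $L$, counted with multiplicity, are $e^{d_1},\ldots,e^{d_m},0,\ldots,0$, with $m'-m$ zeros; and $u_1,\ldots,u_m,u_{m+1},\ldots,u_{m'}$ are corresponding orthonormal eigenvectors, that is, they are orthonormal, $Lu_i=e^{d_i}u_i$ for $1\le i\le m$, and $Lu_j=0$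 for $m<j\le m'$. -/

import Mathlib

open Filter Topology

open scoped MatrixOrder

/-! Write `A t` for the weighted sum over the `w i` and `D_t` for the same sum over the `u i`.
Gram–Schmidt is triangular in both directions: `w i` is a combination of `u j` with `j ≤ i`, and
conversely. As `d` is antitone, replacing the weight at `i` by that at `j ≤ i` only increases it, so
Cauchy–Schwarz gives `c⁻¹ D_t ≤ A t ≤ C D_t` with constants independent of `t ≥ 0`
(`exists_sum_exp_mul_inner_sq_le`). For `t ≥ 1`, Löwner–Heinz (`Matrix.rpow_le_rpow_real`) preserves
these bounds under the power `1/t`. Since `D_t ^ (1/t)` is a fixed matrix `L`, and `c⁻¹` and `C` to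
the power `1/t` tend to 1, a squeeze gives the limit. -/

open scoped Matrix.Norms.L2Operator ComplexOrder in
theorem Matrix.complex_rpow_le_rpow {n : Type*} [Fintype n] [DecidableEq n] {p : ℝ}
    (hp : p ∈ Set.Icc (0 : ℝ) 1) {A B : Matrix n n ℂ} (h : A ≤ B) : A ^ p ≤ B ^ p :=
  CFC.rpow_le_rpow hp h

-- Transfers the Löwner order between ℝ and ℂ, so that Löwner–Heinz over ℂ descends to real
-- matrices. One direction tests on real vectors; the other complexifies a factorization `star B *
-- B`.
open scoped ComplexOrder in
theorem Matrix.posSemidef_map_ofReal_iff {n : Type*} [Fintype n] {A : Matrix n n ℝ} :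
    (A.map Complex.ofReal).PosSemidef ↔ A.PosSemidef := by
  classical
  constructor
  · intro h
    refine .of_dotProduct_mulVec_nonneg ?_ fun x => ?_
    · ext i j
      have := congrFun (congrFun h.1 i) j
      simpa using this
    · have := h.dotProduct_mulVec_nonneg (fun i => (x i : ℂ))
      have e : star (fun i => (x i : ℂ)) ⬝ᵥ (A.map Complex.ofReal).mulVec (fun i => (x i : ℂ))
          = ((star x ⬝ᵥ A.mulVec x : ℝ) : ℂ) := by
        simp [dotProduct, Matrix.mulVec]
      rw [e] at this
      exact_mod_cast this
  · intro h
    obtain ⟨B, rfl⟩ := CStarAlgebra.nonneg_iff_eq_star_mul_self.mp h.nonneg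
    have : (star B * B).map Complex.ofReal
        = (B.map Complex.ofReal).conjTranspose * B.map Complex.ofReal := by
      ext i j
      simp [Matrix.mul_apply, Matrix.star_apply]
    rw [this]
    exact Matrix.posSemidef_conjTranspose_mul_self _

-- Complexification is a continuous star homomorphism, so it commutes with the functional calculus;
-- continuity on the spectrum is free because the spectrum is finite.
open scoped ComplexOrder in
theorem Matrix.map_ofReal_rpow {n : Type*} [Fintype n] [DecidableEq n] {A : Matrix n n ℝ}
    (hA : 0 ≤ A) (p : ℝ) : (A ^ p).map Complex.ofReal = A.map Complex.ofReal ^ p := by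
  let φ : Matrix n n ℝ →⋆ₐ[ℝ] Matrix n n ℂ :=
    { Complex.ofRealAm.mapMatrix with
      map_star' := fun M => by ext i j; simp [Matrix.star_apply] }
  have hφ : ∀ M, φ M = M.map Complex.ofReal := fun M => rfl
  have hA' : 0 ≤ φ A := (Matrix.posSemidef_map_ofReal_iff.mpr (Matrix.nonneg_iff_posSemidef.mp hA)).nonneg
  have hc : Continuous φ := φ.toAlgHom.toLinearMap.continuous_of_finiteDimensional
  rw [← hφ, ← hφ, CFC.rpow_eq_cfc_real hA, CFC.rpow_eq_cfc_real hA']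
  have hs : (spectrum ℝ A).Finite := Matrix.finite_real_spectrum (A := A)
  exact φ.map_cfc _ A (hs.continuousOn _) hc (.of_nonneg hA) (.of_nonneg hA')

open scoped ComplexOrder in
/-- Löwner–Heinz for real matrices. -/
theorem Matrix.rpow_le_rpow_real {n : Type*} [Fintype n] [DecidableEq n] {p : ℝ}
    (hp : p ∈ Set.Icc (0 : ℝ) 1) {A B : Matrix n n ℝ} (hA : 0 ≤ A) (h : A ≤ B) :
    A ^ p ≤ B ^ p := by
  have hsub : ∀ M N : Matrix n n ℝ,
      (N - M).map Complex.ofReal = N.map Complex.ofReal - M.map Complex.ofReal :=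
    fun M N => by ext i j; simp
  have h' : A.map Complex.ofReal ≤ B.map Complex.ofReal := by
    rw [Matrix.le_iff, ← hsub, Matrix.posSemidef_map_ofReal_iff]
    exact h
  have := Matrix.complex_rpow_le_rpow hp h'
  rwa [← Matrix.map_ofReal_rpow hA, ← Matrix.map_ofReal_rpow (hA.trans h), Matrix.le_iff, ← hsub,
    Matrix.posSemidef_map_ofReal_iff] at this

theorem exists_sum_exp_mul_inner_sq_le {m : ℕ} {E : Type*} [NormedAddCommGroup E]
    [InnerProductSpace ℝ E] {d : Fin m → ℝ} (hd : Antitone d) {a b : Fin m → E}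
    (h : ∀ i, a i ∈ Submodule.span ℝ (b '' Set.Iic i)) :
    ∃ C : ℝ, 0 < C ∧ ∀ t : ℝ, 0 ≤ t → ∀ x : E,
      ∑ i, Real.exp (t * d i) * inner ℝ (a i) x ^ 2 ≤
        C * ∑ i, Real.exp (t * d i) * inner ℝ (b i) x ^ 2 := by
  have h1 : ∀ i, ∃ c : Fin m → ℝ, ∑ j ∈ Finset.Iic i, c j • b j = a i := fun i => by
    have := h i
    rw [← Finset.coe_Iic] at this
    obtain ⟨c, hc⟩ := Submodule.mem_span_image_finset_iff_exists_fun ℝ |>.mp this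
    refine ⟨fun j => if hj : j ∈ Finset.Iic i then c ⟨j, hj⟩ else 0, ?_⟩
    rw [← hc, ← Finset.sum_coe_sort]
    exact Finset.sum_congr rfl fun j _ => by simp only [dif_pos j.2]
  choose c hc using h1
  -- The double sum comes from Cauchy–Schwarz in each row; the extra 1 only ensures positivity.
  refine ⟨1 + ∑ i, ∑ j ∈ Finset.Iic i, c i j ^ 2, by positivity, fun t ht x => ?_⟩
  set Q := ∑ i, Real.exp (t * d i) * inner ℝ (b i) x ^ 2 with hQ
  have hQ0 : 0 ≤ Q := by positivity
  have key : ∀ i, Real.exp (t * d i) * inner ℝ (a i) x ^ 2 ≤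
      (∑ j ∈ Finset.Iic i, c i j ^ 2) * Q := fun i => by
    have e1 : inner ℝ (a i) x = ∑ j ∈ Finset.Iic i, c i j * inner ℝ (b j) x := by
      rw [← hc i, sum_inner]
      simp [real_inner_smul_left]
    have e2 := Finset.sum_mul_sq_le_sq_mul_sq (Finset.Iic i) (c i) (fun j => inner ℝ (b j) x)
    have e3 : Real.exp (t * d i) * ∑ j ∈ Finset.Iic i, inner ℝ (b j) x ^ 2 ≤ Q := by
      rw [Finset.mul_sum]
      refine (Finset.sum_le_sum fun j hj => ?_).trans
        (Finset.sum_le_sum_of_subset_of_nonneg (Finset.subset_univ _) fun j _ _ => by positivity)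
      have := hd (Finset.mem_Iic.mp hj)
      gcongr
    calc _ ≤ Real.exp (t * d i) * ((∑ j ∈ Finset.Iic i, c i j ^ 2) *
          ∑ j ∈ Finset.Iic i, inner ℝ (b j) x ^ 2) := by rw [e1]; gcongr
      _ = (∑ j ∈ Finset.Iic i, c i j ^ 2) * (Real.exp (t * d i) *
          ∑ j ∈ Finset.Iic i, inner ℝ (b j) x ^ 2) := by ring
      _ ≤ _ := by gcongr
  calc _ ≤ ∑ i, (∑ j ∈ Finset.Iic i, c i j ^ 2) * Q := Finset.sum_le_sum fun i _ => key i
    _ ≤ _ := by rw [← Finset.sum_mul, add_mul]; linarith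

/-- By polarization, each entry of a symmetric matrix is a fixed linear combination of three values
of its quadratic form. -/
theorem Matrix.tendsto_of_tendsto_dotProduct_mulVec {n X : Type*} [Fintype n] {l : Filter X}
    {A : X → Matrix n n ℝ} {P : Matrix n n ℝ} (hA : ∀ᶠ t in l, (A t).IsSymm) (hP : P.IsSymm)
    (h : ∀ x : n → ℝ, Tendsto (fun t => x ⬝ᵥ (A t).mulVec x) l (𝓝 (x ⬝ᵥ P.mulVec x))) :
    Tendsto A l (𝓝 P) := by
  classical
  have polar : ∀ M : Matrix n n ℝ, M.IsSymm → ∀ i j, M i j =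
      ((Pi.single i 1 + Pi.single j 1) ⬝ᵥ M.mulVec (Pi.single i 1 + Pi.single j 1)
        - Pi.single i 1 ⬝ᵥ M.mulVec (Pi.single i 1)
        - Pi.single j 1 ⬝ᵥ M.mulVec (Pi.single j 1)) / 2 := fun M hM i j => by
    have := hM.apply i j
    simp [Matrix.mulVec_add, add_dotProduct]
    linarith
  refine tendsto_pi_nhds.mpr fun i => tendsto_pi_nhds.mpr fun j => ?_
  rw [polar P hP i j]
  refine ((((h _).sub (h _)).sub (h _)).div_const 2).congr' ?_
  filter_upwards [hA] with t ht
  exact (polar _ ht i j).symm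

theorem Matrix.tendsto_of_smul_le_of_le_smul {n X : Type*} [Fintype n] {l : Filter X}
    {A : X → Matrix n n ℝ} {P : Matrix n n ℝ} (hP : P.IsSymm) {c C : X → ℝ}
    (hc : Tendsto c l (𝓝 1)) (hC : Tendsto C l (𝓝 1)) (h1 : ∀ᶠ t in l, c t • P ≤ A t)
    (h2 : ∀ᶠ t in l, A t ≤ C t • P) : Tendsto A l (𝓝 P) := by
  refine Matrix.tendsto_of_tendsto_dotProduct_mulVec ?_ hP fun x => ?_
  · filter_upwards [h1] with t ht
    have e : A t = (A t - c t • P) + c t • P := by simp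
    rw [e]
    exact Matrix.IsSymm.add (by simpa using ht.1) (hP.smul _)
  · have L : ∀ {c : X → ℝ}, Tendsto c l (𝓝 1) →
        Tendsto (fun t => c t * (x ⬝ᵥ P.mulVec x)) l (𝓝 (x ⬝ᵥ P.mulVec x)) := fun hc => by
      simpa using hc.mul_const (x ⬝ᵥ P.mulVec x)
    refine tendsto_of_tendsto_of_tendsto_of_le_of_le' (L hc) (L hC) ?_ ?_
    · filter_upwards [h1] with t ht
      have := ht.dotProduct_mulVec_nonneg x
      simpa [Matrix.sub_mulVec, Matrix.smul_mulVec] using this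
    · filter_upwards [h2] with t ht
      have := ht.dotProduct_mulVec_nonneg x
      simpa [Matrix.sub_mulVec, Matrix.smul_mulVec] using this

/-! ### Matrices diagonal in a fixed orthonormal basis -/

namespace OrthonormalBasis

variable {ι n : Type*} [Fintype ι] [Fintype n]
  (b : OrthonormalBasis ι ℝ (EuclideanSpace ℝ n))

/-- The symmetric matrix with eigenvectors `b i` and eigenvalues `f i`. -/
noncomputable def eigenMatrix (f : ι → ℝ) : Matrix n n ℝ :=
  ∑ i, f i • Matrix.vecMulVec (b i).ofLp (b i).ofLp

theorem eigenMatrix_smul (c : ℝ) (f : ι → ℝ) :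
    b.eigenMatrix (c • f) = c • b.eigenMatrix f := by
  simp [eigenMatrix, Finset.smul_sum, smul_smul]

theorem eigenMatrix_isSymm (f : ι → ℝ) : (b.eigenMatrix f).IsSymm := by
  simp [Matrix.IsSymm, eigenMatrix, Matrix.transpose_sum, Matrix.transpose_vecMulVec]

variable [DecidableEq n]

theorem toEuclideanLin_eigenMatrix (f : ι → ℝ) (i : ι) :
    Matrix.toEuclideanLin (b.eigenMatrix f) (b i) = f i • b i := by
  classical
  have h : ∀ j, Matrix.toEuclideanLin (Matrix.vecMulVec (b j).ofLp (b j).ofLp) (b i)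
      = (inner ℝ (b j) (b i) : ℝ) • b j := fun j => by
    ext k
    simp [Matrix.vecMulVec_mulVec, EuclideanSpace.inner_eq_star_dotProduct, dotProduct_comm,
      mul_comm]
  simp [eigenMatrix, map_sum, h, b.inner_eq_ite]

theorem eq_eigenMatrix {f : ι → ℝ} {M : Matrix n n ℝ}
    (h : ∀ i, Matrix.toEuclideanLin M (b i) = f i • b i) : M = b.eigenMatrix f := by
  refine Matrix.toEuclideanLin.injective (b.toBasis.ext fun i => ?_)
  simp [h, toEuclideanLin_eigenMatrix]

theorem eigenMatrix_one : b.eigenMatrix 1 = 1 := by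
  refine (b.eq_eigenMatrix fun i => ?_).symm
  ext; simp

theorem eigenMatrix_mul (f g : ι → ℝ) :
    b.eigenMatrix (f * g) = b.eigenMatrix f * b.eigenMatrix g := by
  refine (b.eq_eigenMatrix fun i => ?_).symm
  have h : ∀ (M N : Matrix n n ℝ) x, Matrix.toEuclideanLin (M * N) x
      = Matrix.toEuclideanLin M (Matrix.toEuclideanLin N x) := fun M N x => by
    ext; simp [Matrix.mulVec_mulVec]
  rw [h, toEuclideanLin_eigenMatrix, map_smul, toEuclideanLin_eigenMatrix, smul_smul, mul_comm]
  rfl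

/-- `eigenMatrix` as an algebra homomorphism. -/
noncomputable def eigenMatrixAlgHom : (ι → ℝ) →ₐ[ℝ] Matrix n n ℝ :=
  AlgHom.ofLinearMap
    { toFun := b.eigenMatrix
      map_add' := fun f g => by simp [eigenMatrix, add_smul, Finset.sum_add_distrib]
      map_smul' := b.eigenMatrix_smul }
    b.eigenMatrix_one b.eigenMatrix_mul

/-- The spectrum lies in the finite range of `f`, where `φ` agrees with a Lagrange interpolant;
polynomials commute with `eigenMatrixAlgHom`. -/
theorem cfc_eigenMatrix (f : ι → ℝ) (φ : ℝ → ℝ) :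
    cfc φ (b.eigenMatrix f) = b.eigenMatrix (φ ∘ f) := by
  classical
  set q : Polynomial ℝ := Lagrange.interpolate (Finset.univ.image f) id φ
  have hq : ∀ i, q.eval (f i) = φ (f i) := fun i =>
    Lagrange.eval_interpolate_at_node (v := id) φ Function.injective_id.injOn
      (Finset.mem_image_of_mem f (Finset.mem_univ i))
  have hs : spectrum ℝ (b.eigenMatrix f) ⊆ Set.range f := by
    refine (AlgHom.spectrum_apply_subset b.eigenMatrixAlgHom f).trans fun x hx => ?_
    rw [Pi.spectrum_eq] at hx
    obtain ⟨i, hi⟩ := Set.mem_iUnion.mp hx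
    exact ⟨i, by simpa [spectrum.mem_iff, sub_eq_zero, eq_comm] using hi⟩
  have hsa : IsSelfAdjoint (b.eigenMatrix f) := b.eigenMatrix_isSymm f
  have e1 : cfc φ (b.eigenMatrix f) = cfc q.eval (b.eigenMatrix f) :=
    cfc_congr fun x hx => by
      obtain ⟨i, rfl⟩ := hs hx
      exact (hq i).symm
  rw [e1, cfc_polynomial q _ hsa]
  refine (Polynomial.aeval_algHom_apply b.eigenMatrixAlgHom f q).trans ?_
  refine congrArg b.eigenMatrix (funext fun i => ?_)
  have := Polynomial.aeval_algHom_apply (Pi.evalAlgHom ℝ (fun _ : ι => ℝ) i) f q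
  simp only [Pi.evalAlgHom_apply, Polynomial.coe_aeval_eq_eval] at this
  rw [← this, hq i]
  rfl

omit [DecidableEq n] in
theorem dotProduct_eigenMatrix_mulVec (f : ι → ℝ) (x : n → ℝ) :
    x ⬝ᵥ (b.eigenMatrix f).mulVec x =
      ∑ i, f i * inner ℝ (b i) (WithLp.toLp 2 x) ^ 2 := by
  simp only [eigenMatrix, Matrix.sum_mulVec, dotProduct_sum]
  refine Finset.sum_congr rfl fun i _ => ?_
  simp [Matrix.smul_mulVec, Matrix.vecMulVec_mulVec, EuclideanSpace.inner_eq_star_dotProduct,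
    dotProduct_comm, sq]

omit [DecidableEq n] in
theorem eigenMatrix_nonneg {f : ι → ℝ} (hf : 0 ≤ f) : 0 ≤ b.eigenMatrix f := by
  refine Matrix.PosSemidef.nonneg
    (.of_dotProduct_mulVec_nonneg (b.eigenMatrix_isSymm f) fun x => ?_)
  rw [star_trivial, dotProduct_eigenMatrix_mulVec]
  exact Finset.sum_nonneg fun i _ => mul_nonneg (hf i) (sq_nonneg _)

theorem eigenMatrix_rpow {f : ι → ℝ} (hf : 0 ≤ f) (p : ℝ) :
    b.eigenMatrix f ^ p = b.eigenMatrix (fun i => f i ^ p) := by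
  rw [CFC.rpow_eq_cfc_real (b.eigenMatrix_nonneg hf), cfc_eigenMatrix]
  rfl

theorem charpoly_eigenMatrix [DecidableEq ι] (f : ι → ℝ) :
    (b.eigenMatrix f).charpoly = ∏ i, (Polynomial.X - Polynomial.C (f i)) := by
  have h : LinearMap.toMatrix b.toBasis b.toBasis (Matrix.toEuclideanLin (b.eigenMatrix f))
      = Matrix.diagonal f := by
    ext i j
    simp [LinearMap.toMatrix_apply, toEuclideanLin_eigenMatrix, Matrix.diagonal_apply]
    aesop
  rw [← Matrix.charpoly_diagonal, ← h, LinearMap.charpoly_toMatrix,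
    Matrix.toEuclideanLin_eq_toLin_orthonormal, Matrix.charpoly_toLin]

end OrthonormalBasis

/-! ### The limit and its eigenvectors -/

theorem proposition3 (m m' : ℕ) (hm : m ≤ m') (d : Fin m → ℝ) (hd : Antitone d)
    (w : Fin m → EuclideanSpace ℝ (Fin m')) (hw : LinearIndependent ℝ w) :
    ∃ L : Matrix (Fin m') (Fin m') ℝ,
      Tendsto
        (fun t : ℝ =>
          (∑ i, Real.exp (t * d i) • Matrix.vecMulVec (w i).ofLp (w i).ofLp) ^ (1 / t))
        atTop (𝓝 L) ∧
      L.charpoly.roots =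
        Finset.univ.val.map (fun i : Fin m => Real.exp (d i)) +
          Multiset.replicate (m' - m) 0 ∧
      ∀ v : OrthonormalBasis (Fin (m' - m)) ℝ ↥(Submodule.span ℝ (Set.range w))ᗮ,
        Orthonormal ℝ
          (Sum.elim (InnerProductSpace.gramSchmidtNormed ℝ w)
            (fun j => (v j : EuclideanSpace ℝ (Fin m')))) ∧
        (∀ i, Module.End.HasEigenvector (Matrix.toEuclideanLin L) (Real.exp (d i))
          (InnerProductSpace.gramSchmidtNormed ℝ w i)) ∧
        (∀ j, Module.End.HasEigenvector (Matrix.toEuclideanLin L) 0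
          (v j : EuclideanSpace ℝ (Fin m'))) := by
  set u := InnerProductSpace.gramSchmidtNormed ℝ w with hu
  have hou : Orthonormal ℝ u := InnerProductSpace.gramSchmidtNormed_orthonormal hw
  have hspan : ∀ s : Fin m, Submodule.span ℝ (u '' Set.Iic s) = Submodule.span ℝ (w '' Set.Iic s) :=
    fun s => by
      rw [hu, InnerProductSpace.span_gramSchmidtNormed, InnerProductSpace.span_gramSchmidt_Iic]
  have hu_mem : ∀ i, u i ∈ Submodule.span ℝ (w '' Set.Iic i) := fun i =>
    hspan i ▸ Submodule.subset_span (Set.mem_image_of_mem u Set.self_mem_Iic)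
  have hw_mem : ∀ i, w i ∈ Submodule.span ℝ (u '' Set.Iic i) := fun i =>
    hspan i ▸ Submodule.subset_span (Set.mem_image_of_mem w Set.self_mem_Iic)
  have horth : ∀ v : OrthonormalBasis (Fin (m' - m)) ℝ ↥(Submodule.span ℝ (Set.range w))ᗮ,
      Orthonormal ℝ (Sum.elim u fun j => (v j : EuclideanSpace ℝ (Fin m'))) := fun v => by
    have hv : Orthonormal ℝ fun j => (v j : EuclideanSpace ℝ (Fin m')) :=
      v.orthonormal.comp_linearIsometry (Submodule.subtypeₗᵢ _)
    have huv : ∀ i j, inner ℝ (u i) (v j : EuclideanSpace ℝ (Fin m')) = 0 := fun i j =>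
      Submodule.inner_right_of_mem_orthogonal
        (Submodule.span_mono (Set.image_subset_range _ _) (hu_mem i)) (v j).2
    refine ⟨?_, ?_⟩
    · rintro (i | i)
      exacts [hou.1 i, hv.1 i]
    · rintro (i | i) (j | j) hij
      · exact hou.2 (by simpa using hij)
      · exact huv i j
      · rw [Sum.elim_inr, Sum.elim_inl, real_inner_comm]
        exact huv j i
      · exact hv.2 (by simpa using hij)
  have hrank : Module.finrank ℝ (Submodule.span ℝ (Set.range w))ᗮ = m' - m := by
    have := (Submodule.span ℝ (Set.range w)).finrank_add_finrank_orthogonal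
    rw [finrank_span_eq_card hw, finrank_euclideanSpace, Fintype.card_fin, Fintype.card_fin] at this
    omega
  have hbasis : ∀ v : OrthonormalBasis (Fin (m' - m)) ℝ ↥(Submodule.span ℝ (Set.range w))ᗮ,
      ∃ b : OrthonormalBasis (Fin m ⊕ Fin (m' - m)) ℝ (EuclideanSpace ℝ (Fin m')),
        (∀ i, b (.inl i) = u i) ∧ ∀ j, b (.inr j) = v j := fun v => by
    have hsp := (horth v).linearIndependent.span_eq_top_of_card_eq_finrank' (by simp [hm])
    exact ⟨.mk (horth v) hsp.ge, fun i => by simp, fun j => by simp⟩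
  -- `L` must be fixed before `v` is given, so an arbitrary completion of `u` is used here.
  obtain ⟨b, hbl, -⟩ := hbasis ((stdOrthonormalBasis ℝ _).reindex (finCongr hrank))
  have heig : ∀ b : OrthonormalBasis (Fin m ⊕ Fin (m' - m)) ℝ (EuclideanSpace ℝ (Fin m')),
      (∀ i, b (.inl i) = u i) → ∀ f : Fin m → ℝ, b.eigenMatrix (Sum.elim f 0) =
        ∑ i, f i • Matrix.vecMulVec (u i).ofLp (u i).ofLp := fun b hb f => by
    simp [OrthonormalBasis.eigenMatrix, hb]
  set D : ℝ → Fin m ⊕ Fin (m' - m) → ℝ := fun t => Sum.elim (fun i => Real.exp (t * d i)) 0 with hD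
  set L := b.eigenMatrix (D 1) with hL
  have hD0 : ∀ t, 0 ≤ D t := fun t => by
    rintro (i | i)
    exacts [(Real.exp_pos _).le, le_rfl]
  have hpow : ∀ (c t : ℝ), 0 < c → 0 < t →
      (c • b.eigenMatrix (D t)) ^ (1 / t) = c ^ (1 / t) • L := fun c t hc ht => by
    rw [← b.eigenMatrix_smul, b.eigenMatrix_rpow (smul_nonneg hc.le (hD0 t)), hL,
      ← b.eigenMatrix_smul]
    congr 1
    funext i
    rcases i with i | i
    · simp only [hD, Pi.smul_apply, Sum.elim_inl, smul_eq_mul, one_mul]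
      rw [Real.mul_rpow hc.le (Real.exp_pos _).le, ← Real.exp_mul]
      congr 2
      field_simp
    -- The kernel stays in the kernel: `0 ^ (1 / t) = 0` because `1 / t ≠ 0`.
    · simp [hD, ht.ne']
  have hlim : ∀ c : ℝ, 0 < c → Tendsto (fun t : ℝ => c ^ (1 / t)) atTop (𝓝 1) := fun c hc => by
    have h0 : Tendsto (fun t : ℝ => 1 / t) atTop (𝓝 0) := by simpa using tendsto_inv_atTop_zero
    simpa using (tendsto_const_nhds (x := c)).rpow h0 (.inl hc.ne')
  set A : ℝ → Matrix (Fin m') (Fin m') ℝ := fun t =>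
    ∑ i, Real.exp (t * d i) • Matrix.vecMulVec (w i).ofLp (w i).ofLp with hA
  have hAsymm : ∀ t, (A t).IsSymm := fun t => by
    simp [Matrix.IsSymm, hA, Matrix.transpose_sum, Matrix.transpose_vecMulVec]
  have hAq : ∀ t x, x ⬝ᵥ (A t).mulVec x =
      ∑ i, Real.exp (t * d i) * inner ℝ (w i) (WithLp.toLp 2 x) ^ 2 := fun t x => by
    simp only [hA, Matrix.sum_mulVec, dotProduct_sum]
    refine Finset.sum_congr rfl fun i _ => ?_
    simp [Matrix.smul_mulVec, Matrix.vecMulVec_mulVec, EuclideanSpace.inner_eq_star_dotProduct,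
      dotProduct_comm, sq]
  have hDq : ∀ t x, x ⬝ᵥ (b.eigenMatrix (D t)).mulVec x =
      ∑ i, Real.exp (t * d i) * inner ℝ (u i) (WithLp.toLp 2 x) ^ 2 := fun t x => by
    rw [b.dotProduct_eigenMatrix_mulVec]
    simp [hD, hbl]
  obtain ⟨C, hC, hCle⟩ := exists_sum_exp_mul_inner_sq_le hd hw_mem
  obtain ⟨c, hc, hcle⟩ := exists_sum_exp_mul_inner_sq_le hd hu_mem
  have hle : ∀ M N : Matrix (Fin m') (Fin m') ℝ, M.IsSymm → N.IsSymm →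
      (∀ x, x ⬝ᵥ M.mulVec x ≤ x ⬝ᵥ N.mulVec x) → M ≤ N := fun M N hM hN h => by
    refine Matrix.le_iff.mpr (.of_dotProduct_mulVec_nonneg (hN.sub hM) fun x => ?_)
    simpa [Matrix.sub_mulVec] using h x
  have hupper : ∀ t, 0 ≤ t → A t ≤ C • b.eigenMatrix (D t) := fun t ht =>
    hle _ _ (hAsymm t) ((b.eigenMatrix_isSymm _).smul _) fun x => by
      rw [Matrix.smul_mulVec, dotProduct_smul, smul_eq_mul, hAq, hDq]
      exact hCle t ht _
  have hlower : ∀ t, 0 ≤ t → c⁻¹ • b.eigenMatrix (D t) ≤ A t := fun t ht =>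
    hle _ _ ((b.eigenMatrix_isSymm _).smul _) (hAsymm t) fun x => by
      rw [Matrix.smul_mulVec, dotProduct_smul, smul_eq_mul, hAq, hDq, inv_mul_le_iff₀ hc]
      exact hcle t ht _
  have hD0' : ∀ (c t : ℝ), 0 < c → 0 ≤ c • b.eigenMatrix (D t) := fun c t hc => by
    rw [← b.eigenMatrix_smul]
    exact b.eigenMatrix_nonneg (smul_nonneg hc.le (hD0 t))
  have hmem : ∀ t : ℝ, 1 ≤ t → 1 / t ∈ Set.Icc (0 : ℝ) 1 := fun t ht =>
    ⟨by positivity, (div_le_one (by positivity)).mpr ht⟩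
  refine ⟨L, ?_, ?_, fun v => ⟨horth v, ?_⟩⟩
  · refine Matrix.tendsto_of_smul_le_of_le_smul (b.eigenMatrix_isSymm _) (hlim c⁻¹ (inv_pos.mpr hc))
      (hlim C hC) ?_ ?_
    · filter_upwards [eventually_ge_atTop 1] with t ht
      have h0 : 0 < t := by positivity
      rw [← hpow _ t (inv_pos.mpr hc) h0]
      exact Matrix.rpow_le_rpow_real (hmem t ht) (hD0' _ t (inv_pos.mpr hc)) (hlower t h0.le)
    · filter_upwards [eventually_ge_atTop 1] with t ht
      have h0 : 0 < t := by positivity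
      rw [← hpow _ t hC h0]
      exact Matrix.rpow_le_rpow_real (hmem t ht)
        ((hD0' _ t (inv_pos.mpr hc)).trans (hlower t h0.le)) (hupper t h0.le)
  · have hroots : (b.eigenMatrix (D 1)).charpoly =
        ((Finset.univ.val.map (fun i : Fin m => Real.exp (d i)) +
          Multiset.replicate (m' - m) 0).map fun a => Polynomial.X - Polynomial.C a).prod := by
      rw [b.charpoly_eigenMatrix, Fintype.prod_sum_type]
      simp [hD, Finset.prod]
      rfl
    rw [hL, hroots, Polynomial.roots_multiset_prod_X_sub_C]
  · obtain ⟨b', hbl', hbr'⟩ := hbasis v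
    -- The completing vectors carry eigenvalue 0, so `L` does not depend on the completion.
    have hL' : L = b'.eigenMatrix (D 1) := by rw [hL, heig b hbl, heig b' hbl']
    have hev : ∀ k, Module.End.HasEigenvector (Matrix.toEuclideanLin L) (D 1 k) (b' k) := fun k =>
      Module.End.hasEigenvector_iff.mpr ⟨Module.End.mem_eigenspace_iff.mpr
        (hL' ▸ b'.toEuclideanLin_eigenMatrix (D 1) k), b'.toBasis.ne_zero k⟩
    refine ⟨fun i => ?_, fun j => ?_⟩
    · simpa [hD, hbl'] using hev (.inl i)
    · simpa [hD, hbr'] using hev (.inr j)
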